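/- Let $d \ge 3$ be an integer, and let $\mathcal{P}_{4;d}$ be the complex vector space of polynomials $F(x,y,z,t) \in \mathbb{C}[x,y,z,t]$ of total degree at most $d$, regarded as an affine space with the coefficients as coordinates. There is a nonempty Zariski open subset $U \subseteq \mathcal{P}_{4;d}$ such that every $F \in U$ has degree exactly $d$ and satisfies the following three properties. 1. $F$ is irreducible in $\mathbb{C}[x,y,z,t]$ and $F \notin \mathbb{C}[z,t]$. 2. There are only finitely many $(z_0,t_0) \in \mathbb{C}^2$ such that $F(x,y,z_0,t_0)$ is reducible, i.e. not an irreducible element of $\mathbb{C}[x,y]$. 3. If $z_0,t_0,z_1,t_1,\lambda \in \mathbb{C}$ satisfy $F(x,y,z_0,t_0) = \lambda F(x,y,z_1,t_1)$ as polynomials in $\mathbb{C}[x,y]$, then $\lambda = 1$ and $(z_1,t_1) = (z_0,t_0)$. -/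

import Mathlib

/-- The vector space `𝒫_{n;d}` of complex polynomials in `n` variables of total degree at most `d`. -/
noncomputable abbrev PolySpace (n d : ℕ) : Submodule ℂ (MvPolynomial (Fin n) ℂ) :=
  MvPolynomial.restrictTotalDegree (Fin n) ℂ d

/-- The finite set of exponents of monomials in `n` variables of degree at most `d`. -/
abbrev MonomialIndex (n d : ℕ) : Type :=
  {m : Fin n →₀ ℕ // m.degree ≤ d}

/-- The coefficient vector of a polynomial: it identifies `𝒫_{n;d}` with an affine space, with
one coordinate for each monomial of degree at most `d`. -/
noncomputable def coeffVec {n d : ℕ} (F : PolySpace n d) : MonomialIndex n d → ℂ :=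
  fun m => MvPolynomial.coeff m.1 F.1

/-- A subset of the affine space `𝒫_{n;d}` is Zariski closed if it is the common zero locus of an
ideal of polynomials in the coefficients. -/
def IsZariskiClosed {n d : ℕ} (Z : Set (PolySpace n d)) : Prop :=
  ∃ I : Ideal (MvPolynomial (MonomialIndex n d) ℂ), Z = coeffVec ⁻¹' MvPolynomial.zeroLocus ℂ I

/-- A subset of `𝒫_{n;d}` is Zariski open if its complement is Zariski closed. -/
def IsZariskiOpen {n d : ℕ} (U : Set (PolySpace n d)) : Prop :=
  IsZariskiClosed Uᶜ

/-- A property holds for a (Zariski) generic polynomial in `𝒫_{n;d}` if it holds for all members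
of some nonempty Zariski open subset (which is then automatically dense). -/
def ForGenericPoly (n d : ℕ) (P : MvPolynomial (Fin n) ℂ → Prop) : Prop :=
  ∃ U : Set (PolySpace n d), IsZariskiOpen U ∧ U.Nonempty ∧ ∀ F ∈ U, P F.1

/-- The specialization `F(x, y, z₀, t₀) ∈ ℂ[x, y]` of `F(x, y, z, t) ∈ ℂ[x, y, z, t]`; the variables
`x, y, z, t` are `X 0, X 1, X 2, X 3`. -/
noncomputable def specializeZT (F : MvPolynomial (Fin 4) ℂ) (z₀ t₀ : ℂ) :
    MvPolynomial (Fin 2) ℂ :=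
  MvPolynomial.aeval ![MvPolynomial.X 0, MvPolynomial.X 1, MvPolynomial.C z₀, MvPolynomial.C t₀] F

/-! The second property carries the weight; the idea is a linear criterion for reducibility in the
style of Ruppert. Let `f` be a fibre of `F`, of degree `d` and with `x ^ d` occurring. If `f`
factors, there is a closed form `(g dx + h dy) / f` independent of `df / f`, with `g`, `h` of degree
below `d` (`exists_closed_form_of_not_irreducible`). Closedness is linear in `g`, `h`, so every
maximal minor of the resulting system, a polynomial in the coefficients of `f`, vanishes
(`det_logMatrix_eq_zero_of_not_irreducible`).

Two of these minors, for `β = 1` and `β = d - 1`, suffice. On the model `x ^ d + y ^ (d - 1) * z + y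
* t ^ (d - 1)` they are triangular up to reordering, and equal nonzero constants times powers of `t`
and of `z` respectively (`exists_det_logMatrix_eq`). These powers attain the degree bounds valid for
all `F` (`natDegree_det_logMatrix_le`), so the resultants eliminating `t` or `z` do not vanish at
the model, hence are nonzero for generic coefficients (`exists_eliminant`). Thus generically both
minors vanish at only finitely many `(z, t)`.

The rest is elementary. As `F` has degree at most `d`, the coefficient of `x ^ d` is constant in
`z`, `t`, so an irreducible fibre forces `F` to be irreducible. The coefficients of `x ^ (d - 1)`
and `x ^ (d - 2) * y` are affine in `z`, `t` and generically determine the point. -/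

namespace MvPolynomial

/-! ### Top coefficients and derivatives -/

variable {σ R : Type*}

theorem coeff_single_add_mul [CommSemiring R] {p q : MvPolynomial σ R} {a b : ℕ} (i : σ)
    (hp : p.totalDegree ≤ a) (hq : q.totalDegree ≤ b) :
    coeff (Finsupp.single i (a + b)) (p * q) =
      coeff (Finsupp.single i a) p * coeff (Finsupp.single i b) q := by
  classical
  rw [coeff_mul]
  refine Finset.sum_eq_single (Finsupp.single i a, Finsupp.single i b) ?_ ?_
  · rintro ⟨u, v⟩ huv hne
    rw [Finset.HasAntidiagonal.mem_antidiagonal] at huv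
    dsimp only at huv ⊢
    by_contra h0
    have hu : u.degree ≤ a := (le_totalDegree (mem_support_iff.2 (left_ne_zero_of_mul h0))).trans hp
    have hv : v.degree ≤ b :=
      (le_totalDegree (mem_support_iff.2 (right_ne_zero_of_mul h0))).trans hq
    have hdeg : u.degree + v.degree = a + b := by
      rw [← map_add, huv, Finsupp.degree_single]
    have key : ∀ w : σ →₀ ℕ, w ≤ Finsupp.single i (a + b) →
        w = Finsupp.single i w.degree := by
      intro w hw
      have hs : w = Finsupp.single i (w i) := by
        ext j
        by_cases hj : i = j
        · subst hj; simp
        · have := hw j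
          rw [Finsupp.single_eq_of_ne' hj] at this ⊢
          omega
      rw [hs, Finsupp.degree_single]
    have h1 := key u (huv ▸ le_self_add)
    have h2 := key v (huv ▸ le_add_self)
    apply hne
    rw [h1, h2, show u.degree = a by omega, show v.degree = b by omega]
  · intro h
    exact absurd (Finset.HasAntidiagonal.mem_antidiagonal.2 (Finsupp.single_add i a b).symm) h

theorem totalDegree_pderiv_le [CommSemiring R] (p : MvPolynomial σ R) (i : σ) :
    (pderiv i p).totalDegree ≤ p.totalDegree - 1 := by
  refine Finset.sup_le fun m hm => ?_
  rw [mem_support_iff, coeff_pderiv] at hm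
  have h := le_totalDegree (mem_support_iff.2 (left_ne_zero_of_mul hm))
  change (m + Finsupp.single i 1).degree ≤ _ at h
  rw [map_add, Finsupp.degree_single] at h
  change m.degree ≤ _
  omega

theorem pderiv_comm [CommSemiring R] (p : MvPolynomial σ R) (i j : σ) :
    pderiv i (pderiv j p) = pderiv j (pderiv i p) := by
  classical
  by_cases hij : i = j
  · rw [hij]
  ext m
  simp only [coeff_pderiv, Finsupp.add_apply, Finsupp.single_eq_of_ne' hij,
    Finsupp.single_eq_of_ne' (Ne.symm hij), add_zero, add_right_comm m]
  ring

end MvPolynomial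

/-! ### Closed logarithmic forms from factorizations -/

section LogForm

open MvPolynomial

/-- A polynomial of degree at most `d` in which `x ^ d` occurs, and which is not irreducible,
admits a closed form `(g dx + h dy) / f` that is not a multiple of `df / f`. -/
theorem exists_closed_form_of_not_irreducible {f : MvPolynomial (Fin 2) ℂ} {d : ℕ} (hd : 1 ≤ d)
    (hdeg : f.totalDegree ≤ d) (hf : coeff (Finsupp.single 0 d) f ≠ 0) (hirr : ¬ Irreducible f) :
    ∃ g h : MvPolynomial (Fin 2) ℂ, g.totalDegree < d ∧ h.totalDegree < d ∧
      coeff (Finsupp.single 0 (d - 1)) g = 0 ∧ g ≠ 0 ∧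
      f * pderiv 1 g - g * pderiv 1 f = f * pderiv 0 h - h * pderiv 0 f := by
  have hf0 : f ≠ 0 := by rintro rfl; simp at hf
  have hdeg' : f.totalDegree = d := by
    refine le_antisymm hdeg ?_
    simpa [Finsupp.degree_single] using le_totalDegree (mem_support_iff.2 hf)
  have hunit : ∀ p : MvPolynomial (Fin 2) ℂ, p ≠ 0 → ¬ IsUnit p → 1 ≤ p.totalDegree := by
    intro p hp0 hp
    by_contra h
    have h0 := totalDegree_eq_zero_iff_eq_C.1 (show p.totalDegree = 0 by omega)
    apply hp
    rw [h0]
    refine (IsUnit.mk0 _ fun h1 => hp0 ?_).map C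
    rw [h0, h1, C_0]
  have htop : ∀ p q : MvPolynomial (Fin 2) ℂ, p * q = f →
      p.totalDegree + q.totalDegree = d ∧ coeff (Finsupp.single 0 p.totalDegree) p ≠ 0 := by
    intro p q hpq
    have hp0 : p ≠ 0 := by rintro rfl; simp at hpq; exact hf0 hpq.symm
    have hq0 : q ≠ 0 := by rintro rfl; simp at hpq; exact hf0 hpq.symm
    have h := totalDegree_mul_of_isDomain hp0 hq0
    rw [hpq, hdeg'] at h
    refine ⟨h.symm, fun h0 => hf ?_⟩
    rw [h, ← hpq, coeff_single_add_mul 0 le_rfl le_rfl, h0, zero_mul]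
  have hpd : ∀ p : MvPolynomial (Fin 2) ℂ, 1 ≤ p.totalDegree →
      coeff (Finsupp.single 0 p.totalDegree) p ≠ 0 → coeff (Finsupp.single 0 (p.totalDegree - 1))
        (pderiv 0 p) = p.totalDegree * coeff (Finsupp.single 0 p.totalDegree) p := by
    intro p h1 h2
    rw [coeff_pderiv, ← Finsupp.single_add, Nat.sub_add_cancel h1, Finsupp.single_eq_same,
      Nat.cast_sub h1]
    push_cast
    ring
  have hfu : ¬ IsUnit f := fun hu => by
    have := (isUnit_iff_totalDegree_of_isReduced.1 hu).2
    omega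
  obtain ⟨p, q, hpq, hp, hq⟩ : ∃ p q, f = p * q ∧ ¬ IsUnit p ∧ ¬ IsUnit q := by
    by_contra! hcon
    refine hirr ⟨hfu, fun a b hab => ?_⟩
    by_contra! h
    exact h.2 (hcon a b hab h.1)
  -- For coprime factors the form is `deg q * dp / p - deg p * dq / q`. The weights are the degrees,
  -- so that the two contributions to `x ^ (d - 1)` in `g` cancel.
  by_cases hrel : IsRelPrime p q
  · have hp0 : p ≠ 0 := by rintro rfl; simp [hpq] at hf0
    have hq0 : q ≠ 0 := by rintro rfl; simp [hpq] at hf0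
    obtain ⟨hab, hpt⟩ := htop p q hpq.symm
    obtain ⟨-, hqt⟩ := htop q p (by rw [hpq, mul_comm])
    have hp1 := hunit p hp0 hp
    have hq1 := hunit q hq0 hq
    have hbound : ∀ i, (C (q.totalDegree : ℂ) * (q * pderiv i p) -
        C (p.totalDegree : ℂ) * (p * pderiv i q)).totalDegree < d := by
      intro i
      refine (totalDegree_sub _ _).trans_lt (max_lt ?_ ?_) <;>
        refine (totalDegree_mul _ _).trans_lt ?_ <;> rw [totalDegree_C, zero_add] <;>
        refine (totalDegree_mul _ _).trans_lt ?_
      · have := totalDegree_pderiv_le p i; omega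
      · have := totalDegree_pderiv_le q i; omega
    refine ⟨_, _, hbound 0, hbound 1, ?_, fun h0 => ?_, ?_⟩
    · have e1 : d - 1 = q.totalDegree + (p.totalDegree - 1) := by omega
      have e2 : d - 1 = p.totalDegree + (q.totalDegree - 1) := by omega
      rw [coeff_sub, coeff_C_mul, coeff_C_mul, e1,
        coeff_single_add_mul 0 le_rfl (totalDegree_pderiv_le p 0), ← e1, e2,
        coeff_single_add_mul 0 le_rfl (totalDegree_pderiv_le q 0), hpd p hp1 hpt, hpd q hq1 hqt]
      ring
    -- If `g` vanished, coprimality would make `p` divide its own nonzero `x`-derivative, which has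
    -- smaller degree.
    · have hdvd : p ∣ q * (C (q.totalDegree : ℂ) * pderiv 0 p) :=
        ⟨C (p.totalDegree : ℂ) * pderiv 0 q, by linear_combination h0⟩
      have hdvd2 := hrel.dvd_of_dvd_mul_left hdvd
      have hne : C (q.totalDegree : ℂ) * pderiv 0 p ≠ 0 := by
        refine mul_ne_zero (by simpa using (by omega : q.totalDegree ≠ 0)) fun h => ?_
        have := hpd p hp1 hpt
        rw [h, coeff_zero] at this
        exact mul_ne_zero (by exact_mod_cast (by omega : p.totalDegree ≠ 0)) hpt this.symm
      have h1 := totalDegree_le_of_dvd_of_isDomain hdvd2 hne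
      have h2 := totalDegree_mul (C (q.totalDegree : ℂ)) (pderiv 0 p)
      have h3 := totalDegree_pderiv_le p 0
      rw [totalDegree_C] at h2
      omega
    · rw [hpq]
      simp only [map_sub, pderiv_mul, pderiv_C, pderiv_comm _ (1 : Fin 2) 0]
      ring
  -- With a repeated factor, `f = s ^ 2 * m` and the form is the exact one `ds / s ^ 2 = m ds / f`.
  -- Its numerators have degree at most `d - 2`.
  · obtain ⟨s, ⟨p', rfl⟩, ⟨q', rfl⟩, hs⟩ : ∃ s, s ∣ p ∧ s ∣ q ∧ ¬ IsUnit s := by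
      simpa [IsRelPrime] using hrel
    obtain ⟨m, hm⟩ : ∃ m, f = s * (s * m) := ⟨p' * q', by rw [hpq]; ring⟩
    have hs0 : s ≠ 0 := by rintro rfl; simp [hm] at hf0
    have hm0 : m ≠ 0 := by rintro rfl; simp [hm] at hf0
    have hs1 := hunit s hs0 hs
    obtain ⟨hdeg1, hst⟩ := htop s _ hm.symm
    rw [totalDegree_mul_of_isDomain hs0 hm0] at hdeg1
    have hbound : ∀ i, (m * pderiv i s).totalDegree < d - 1 := by
      intro i
      have h1 := totalDegree_mul m (pderiv i s)
      have h2 := totalDegree_pderiv_le s i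
      omega
    refine ⟨m * pderiv 0 s, m * pderiv 1 s, (hbound 0).trans_le (by omega),
      (hbound 1).trans_le (by omega), ?_, mul_ne_zero hm0 fun h => ?_, ?_⟩
    · refine coeff_eq_zero_of_totalDegree_lt ?_
      change _ < (Finsupp.single (0 : Fin 2) (d - 1)).degree
      rw [Finsupp.degree_single]
      exact hbound 0
    · have := hpd s hs1 hst
      rw [h, coeff_zero] at this
      exact mul_ne_zero (by exact_mod_cast (by omega : s.totalDegree ≠ 0)) hst this.symm
    · rw [hm]
      simp only [pderiv_mul, pderiv_comm _ (1 : Fin 2) 0]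
      ring

end LogForm

/-! ### The linear system for closed forms and its square minors -/

section LogMatrix

open MvPolynomial

theorem MvPolynomial.coeff_X_mul_pderiv {σ R : Type*} [CommSemiring R] (p : MvPolynomial σ R)
    (i : σ) (m : σ →₀ ℕ) : coeff m (X i * pderiv i p) = m i * coeff m p := by
  classical
  induction p using MvPolynomial.induction_on' with
  | monomial u a =>
    rw [X_mul_pderiv_monomial, coeff_smul, coeff_monomial]
    split_ifs with h
    · rw [h, nsmul_eq_mul]
    · simp
  | add p q hp hq => rw [map_add, mul_add, coeff_add, hp, hq, coeff_add, mul_add]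

/-- The exponent of the monomial `x ^ p.1 * y ^ p.2`. -/
noncomputable def expo (p : ℕ × ℕ) : Fin 2 →₀ ℕ := Finsupp.single 0 p.1 + Finsupp.single 1 p.2

@[simp] theorem expo_zero (p : ℕ × ℕ) : expo p 0 = p.1 := by simp [expo]

@[simp] theorem expo_one (p : ℕ × ℕ) : expo p 1 = p.2 := by simp [expo]

theorem expo_mk_self (m : Fin 2 →₀ ℕ) : expo (m 0, m 1) = m := by
  ext i; fin_cases i <;> simp

theorem expo_injective : Function.Injective expo := fun p q h =>
  Prod.ext (by simpa using DFunLike.congr_fun h 0) (by simpa using DFunLike.congr_fun h 1)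

theorem expo_le_iff {p q : ℕ × ℕ} : expo p ≤ expo q ↔ p ≤ q := by
  refine ⟨fun h => ⟨by simpa using h 0, by simpa using h 1⟩, fun h i => ?_⟩
  fin_cases i
  · simpa using h.1
  · simpa using h.2

theorem expo_sub (p q : ℕ × ℕ) : expo p - expo q = expo (p - q) := by
  ext i; fin_cases i <;> simp

theorem expo_degree (p : ℕ × ℕ) : (expo p).degree = p.1 + p.2 := by
  simp only [expo, map_add, Finsupp.degree_single]

theorem degree_fin_two (m : Fin 2 →₀ ℕ) : m.degree = m 0 + m 1 := by
  rw [← expo_mk_self m, expo_degree]; simp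

theorem eq_sum_monomial_expo {p : MvPolynomial (Fin 2) ℂ} {S : Finset (ℕ × ℕ)}
    (h : ∀ m ∈ p.support, (m 0, m 1) ∈ S) :
    p = ∑ v : S, monomial (expo v) (coeff (expo v) p) := by
  rw [Finset.sum_coe_sort S fun v => monomial (expo v) (coeff (expo v) p)]
  ext m
  rw [coeff_sum]
  simp only [coeff_monomial]
  by_cases hm : coeff m p = 0
  · rw [hm]
    refine (Finset.sum_eq_zero fun v _ => ?_).symm
    split_ifs with h1
    · rw [h1, hm]
    · rfl
  · rw [Finset.sum_eq_single_of_mem (m 0, m 1) (h m (mem_support_iff.2 hm)) fun v _ hv => ?_]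
    · rw [expo_mk_self, if_pos rfl]
    · rw [if_neg]
      rintro rfl
      exact hv (by simp)

/-- If `f` is not irreducible, then the logarithmic equation in the unknowns `γ`, `η` obtained by
putting `g = (d - 1) γ - x γ_x` and `h = η - x γ_y` has a nontrivial solution. -/
theorem exists_log_solution_of_not_irreducible {f : MvPolynomial (Fin 2) ℂ} {d : ℕ} (hd : 2 ≤ d)
    (hdeg : f.totalDegree ≤ d) (hf : coeff (Finsupp.single 0 d) f ≠ 0) (hirr : ¬ Irreducible f) :
    ∃ γ η : MvPolynomial (Fin 2) ℂ, γ ≠ 0 ∧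
      (∀ m ∈ γ.support, m 0 + m 1 < d ∧ m 0 + 1 < d) ∧ (∀ m ∈ η.support, m 0 + m 1 < d) ∧
      C (d : ℂ) * f * pderiv 1 γ - C (d - 1 : ℂ) * γ * pderiv 1 f
        + X 0 * (pderiv 0 γ * pderiv 1 f - pderiv 1 γ * pderiv 0 f)
        - f * pderiv 0 η + η * pderiv 0 f = 0 := by
  classical
  obtain ⟨g, h, hg, hh, hgt, hg0, heq⟩ :=
    exists_closed_form_of_not_irreducible (by omega) hdeg hf hirr
  -- The operator `(d - 1) - x ∂/∂x` multiplies a monomial by `d - 1 - m 0`. In degree below `d`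
  -- this is zero only on `x ^ (d - 1)`, which is absent from `g`, so the operator can be inverted
  -- there.
  set γ : MvPolynomial (Fin 2) ℂ :=
    ∑ m ∈ g.support, monomial m (coeff m g / (d - 1 - m 0 : ℂ)) with hγ
  have hcoeff : ∀ m, coeff m γ = coeff m g / (d - 1 - m 0 : ℂ) := by
    intro m
    rw [hγ, coeff_sum]
    simp only [coeff_monomial]
    rw [Finset.sum_ite_eq' g.support m]
    split_ifs with hm
    · rfl
    · rw [notMem_support_iff.1 hm, zero_div]
  have hgs : ∀ m, coeff m g ≠ 0 → m 0 + m 1 < d ∧ m 0 + 1 < d := by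
    intro m hm
    have h1 : m.degree ≤ g.totalDegree := le_totalDegree (mem_support_iff.2 hm)
    rw [degree_fin_two] at h1
    refine ⟨by omega, ?_⟩
    by_contra h2
    apply hm
    rw [← hgt, show m = Finsupp.single 0 (d - 1) from ?_]
    ext i
    fin_cases i
    · simp; omega
    · simp; omega
  have hγs : ∀ m ∈ γ.support, m 0 + m 1 < d ∧ m 0 + 1 < d := by
    intro m hm
    refine hgs m fun h0 => ?_
    rw [mem_support_iff, hcoeff, h0, zero_div] at hm
    exact hm rfl
  have hgγ : g = C (d - 1 : ℂ) * γ - X 0 * pderiv 0 γ := by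
    ext m
    rw [coeff_sub, coeff_C_mul, coeff_X_mul_pderiv, hcoeff]
    by_cases hm : coeff m g = 0
    · simp [hm]
    · have : (d - 1 - m 0 : ℂ) ≠ 0 := by
        have := (hgs m hm).2
        intro h0
        have : (d : ℂ) = (m 0 + 1 : ℕ) := by push_cast; linear_combination h0
        have := Nat.cast_injective this
        omega
      field_simp
  have hγd : γ.totalDegree < d := by
    rw [totalDegree, Finset.sup_lt_iff (by simp; omega)]
    intro m hm
    have := (hγs m hm).1
    rw [← degree_fin_two] at this
    exact this
  -- Adding `x γ_y` to `h` makes the term `x ^ d` of `f` cancel from everything involving `γ`; this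
  -- is what makes the minors triangular later.
  refine ⟨γ, h + X 0 * pderiv 1 γ, ?_, hγs, ?_, ?_⟩
  · intro h0
    rw [h0] at hgγ
    simp [hg0] at hgγ
  · intro m hm
    have h1 : m.degree ≤ _ := le_totalDegree hm
    have h2 := totalDegree_add h (X 0 * pderiv 1 γ)
    have h3 := totalDegree_mul (X 0) (pderiv 1 γ)
    have h4 := totalDegree_pderiv_le γ 1
    rw [totalDegree_X] at h3
    rw [degree_fin_two] at h1
    have := h1.trans h2
    rw [le_max_iff] at this
    omega
  · rw [hgγ] at heq
    simp only [map_sub, map_add, pderiv_mul, pderiv_C, pderiv_X_self,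
      pderiv_X_of_ne (show (0 : Fin 2) ≠ 1 by decide), pderiv_comm _ (1 : Fin 2) 0] at heq ⊢
    have hC : (C (d : ℂ) : MvPolynomial (Fin 2) ℂ) = C (d - 1 : ℂ) + 1 := by
      rw [← C_1, ← C_add]; ring_nf
    rw [map_sub] at hC
    linear_combination heq + f * pderiv 1 γ * hC

/-- The exponents of the monomials of `η`. -/
def etaExps (d : ℕ) : Finset (ℕ × ℕ) :=
  (Finset.range d ×ˢ Finset.range d).filter fun p => p.1 + p.2 < d

/-- The exponents of the monomials of `γ`. -/
def gammaExps (d : ℕ) : Finset (ℕ × ℕ) :=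
  (Finset.range d ×ˢ Finset.range d).filter fun p => p.1 + p.2 < d ∧ p.1 + 1 < d

theorem mem_etaExps {d : ℕ} {p : ℕ × ℕ} : p ∈ etaExps d ↔ p.1 + p.2 < d := by
  simp [etaExps]; omega

theorem mem_gammaExps {d : ℕ} {p : ℕ × ℕ} : p ∈ gammaExps d ↔ p.1 + p.2 < d ∧ p.1 + 1 < d := by
  simp [gammaExps]; omega

/-- The index type of the unknown coefficients of `η` and `γ`. -/
abbrev LogIndex (d : ℕ) : Type := etaExps d ⊕ gammaExps d

/-- The exponent by which the column of an unknown shifts the coefficients of `f`. -/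
def logShift (d : ℕ) : LogIndex d → ℕ × ℕ
  | .inl v => (v.1.1, v.1.2 + 1)
  | .inr v => (v.1.1 + 1, v.1.2)

/-- The factor of the coefficient of `x ^ p.1 * y ^ p.2` of `f` in the column of an unknown. -/
def logWeight (d : ℕ) : LogIndex d → ℕ × ℕ → ℤ
  | .inl v, p => p.1 - v.1.1
  | .inr v, p => v.1.2 * d - v.1.2 * p.1 - (d - 1 - v.1.1) * p.2

/-- A choice of as many rows of the logarithmic equation as there are unknowns. -/
def logRow (d β : ℕ) : LogIndex d → ℕ × ℕ
  | .inl v => (v.1.1 + d, v.1.2 + 1)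
  | .inr v => (v.1.1 + 1, v.1.2 + β)

/-- A square submatrix of the matrix of the logarithmic equation, for a polynomial with
coefficients `c`. -/
def logMatrix {A : Type*} [CommRing A] (d β : ℕ) (c : ℕ × ℕ → A) :
    Matrix (LogIndex d) (LogIndex d) A :=
  .of fun r v => if logShift d v ≤ logRow d β r then
    (logWeight d v (logRow d β r - logShift d v) : A) * c (logRow d β r - logShift d v) else 0

theorem logMatrix_map {A A' : Type*} [CommRing A] [CommRing A'] (φ : A →+* A') (d β : ℕ)
    (c : ℕ × ℕ → A) : φ (logMatrix d β c).det = (logMatrix d β fun p => φ (c p)).det := by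
  rw [RingHom.map_det]
  congr 1
  ext r v
  simp only [logMatrix, RingHom.mapMatrix_apply, Matrix.map_apply, Matrix.of_apply, apply_ite φ,
    map_mul, map_intCast, map_zero]

/-- The part of the logarithmic equation, multiplied by `x * y`, that involves `γ`. -/
noncomputable def gammaPart (d : ℕ) (f : MvPolynomial (Fin 2) ℂ) :
    MvPolynomial (Fin 2) ℂ →ₗ[ℂ] MvPolynomial (Fin 2) ℂ where
  toFun γ := X 0 * (C (d : ℂ) * f * (X 1 * pderiv 1 γ) - C (d - 1 : ℂ) * γ * (X 1 * pderiv 1 f)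
    + (X 0 * pderiv 0 γ) * (X 1 * pderiv 1 f) - (X 1 * pderiv 1 γ) * (X 0 * pderiv 0 f))
  map_add' a b := by simp only [map_add]; ring
  map_smul' a b := by simp only [smul_eq_C_mul, pderiv_C_mul, RingHom.id_apply]; ring

/-- The part of the logarithmic equation, multiplied by `x * y`, that involves `η`. -/
noncomputable def etaPart (f : MvPolynomial (Fin 2) ℂ) :
    MvPolynomial (Fin 2) ℂ →ₗ[ℂ] MvPolynomial (Fin 2) ℂ where
  toFun η := X 1 * (η * (X 0 * pderiv 0 f) - f * (X 0 * pderiv 0 η))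
  map_add' a b := by simp only [map_add]; ring
  map_smul' a b := by simp only [smul_eq_C_mul, pderiv_C_mul, RingHom.id_apply]; ring

theorem gammaPart_apply (d : ℕ) (f γ : MvPolynomial (Fin 2) ℂ) : gammaPart d f γ =
    X 0 * (C (d : ℂ) * f * (X 1 * pderiv 1 γ) - C (d - 1 : ℂ) * γ * (X 1 * pderiv 1 f)
      + (X 0 * pderiv 0 γ) * (X 1 * pderiv 1 f) - (X 1 * pderiv 1 γ) * (X 0 * pderiv 0 f)) := rfl

theorem etaPart_apply (f η : MvPolynomial (Fin 2) ℂ) : etaPart f η =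
    X 1 * (η * (X 0 * pderiv 0 f) - f * (X 0 * pderiv 0 η)) := rfl

theorem X_zero_mul_monomial_expo (p : ℕ × ℕ) (a : ℂ) :
    X 0 * monomial (expo p) a = monomial (expo (p.1 + 1, p.2)) a := by
  rw [X, monomial_mul, one_mul]
  congr 2
  ext i; fin_cases i <;> simp [add_comm]

theorem X_one_mul_monomial_expo (p : ℕ × ℕ) (a : ℂ) :
    X 1 * monomial (expo p) a = monomial (expo (p.1, p.2 + 1)) a := by
  rw [X, monomial_mul, one_mul]
  congr 2
  ext i; fin_cases i <;> simp [add_comm]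

theorem X_mul_pderiv_monomial_C (m : Fin 2 →₀ ℕ) (i : Fin 2) (a : ℂ) :
    X i * pderiv i (monomial m a) = C (m i : ℂ) * monomial m a := by
  rw [X_mul_pderiv_monomial, nsmul_eq_mul, map_natCast]

/-- After multiplication by `x * y` only the Euler operators `x ∂/∂x` and `y ∂/∂y` occur. They are
diagonal on monomials, so a column is a shift of the coefficients of `f` with scalar weights. -/
theorem coeff_gammaPart_monomial (d : ℕ) (f : MvPolynomial (Fin 2) ℂ) (v : gammaExps d) (a : ℂ)
    (r : ℕ × ℕ) : coeff (expo r) (gammaPart d f (monomial (expo v) a)) =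
      (if logShift d (.inr v) ≤ r then (logWeight d (.inr v) (r - logShift d (.inr v)) : ℂ) *
        coeff (expo (r - logShift d (.inr v))) f else 0) * a := by
  have h : gammaPart d f (monomial (expo v) a) = monomial (expo (logShift d (.inr v))) a *
      (C (v.1.2 * d : ℂ) * f - C (d - 1 - v.1.1 : ℂ) * (X 1 * pderiv 1 f)
        - C (v.1.2 : ℂ) * (X 0 * pderiv 0 f)) := by
    rw [gammaPart_apply, X_mul_pderiv_monomial_C, X_mul_pderiv_monomial_C, expo_zero, expo_one,
      logShift, ← X_zero_mul_monomial_expo, C_mul, C_sub (σ := Fin 2) (d - 1 : ℂ)]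
    ring
  rw [h, coeff_monomial_mul', expo_sub]
  simp only [expo_le_iff, coeff_sub, coeff_C_mul, coeff_X_mul_pderiv, expo_zero, expo_one]
  split_ifs
  · simp only [logWeight]
    push_cast
    ring
  · simp

theorem coeff_etaPart_monomial (d : ℕ) (f : MvPolynomial (Fin 2) ℂ) (v : etaExps d) (a : ℂ)
    (r : ℕ × ℕ) : coeff (expo r) (etaPart f (monomial (expo v) a)) =
      (if logShift d (.inl v) ≤ r then (logWeight d (.inl v) (r - logShift d (.inl v)) : ℂ) *
        coeff (expo (r - logShift d (.inl v))) f else 0) * a := by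
  have h : etaPart f (monomial (expo v) a) = monomial (expo (logShift d (.inl v))) a *
      (X 0 * pderiv 0 f - C (v.1.1 : ℂ) * f) := by
    rw [etaPart_apply, X_mul_pderiv_monomial_C, expo_zero, logShift, ← X_one_mul_monomial_expo]
    ring
  rw [h, coeff_monomial_mul', expo_sub]
  simp only [expo_le_iff, coeff_sub, coeff_C_mul, coeff_X_mul_pderiv, expo_zero]
  split_ifs
  · simp only [logWeight]
    push_cast
    ring
  · simp

/-- The coefficients of `η` and `γ` form a kernel vector, nonzero because `γ ≠ 0`, whichever rows
are selected. -/
theorem det_logMatrix_eq_zero_of_not_irreducible {f : MvPolynomial (Fin 2) ℂ} {d : ℕ} (hd : 2 ≤ d)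
    (hdeg : f.totalDegree ≤ d) (hf : coeff (Finsupp.single 0 d) f ≠ 0) (hirr : ¬ Irreducible f)
    (β : ℕ) : (logMatrix d β fun p => coeff (expo p) f).det = 0 := by
  obtain ⟨γ, η, hγ0, hγ, hη, heq⟩ := exists_log_solution_of_not_irreducible hd hdeg hf hirr
  have hsum : gammaPart d f γ + etaPart f η = 0 := by
    rw [gammaPart_apply, etaPart_apply]
    linear_combination X 0 * X 1 * heq
  have hγS : ∀ m ∈ γ.support, (m 0, m 1) ∈ gammaExps d := fun m hm => mem_gammaExps.2 (hγ m hm)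
  rw [← Matrix.exists_mulVec_eq_zero_iff]
  refine ⟨Sum.elim (fun v => coeff (expo v) η) (fun v => coeff (expo v) γ), fun h0 => hγ0 ?_, ?_⟩
  · ext m
    by_contra hm
    have h1 := congrFun h0 (.inr ⟨_, hγS m (mem_support_iff.2 hm)⟩)
    simp only [Sum.elim_inr, expo_mk_self, Pi.zero_apply] at h1
    exact hm (by rw [h1, coeff_zero])
  · ext r
    have h1 := congrArg (coeff (expo (logRow d β r))) hsum
    rw [eq_sum_monomial_expo hγS, eq_sum_monomial_expo fun m hm => mem_etaExps.2 (hη m hm),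
      map_sum, map_sum, coeff_add, coeff_sum, coeff_sum] at h1
    simp only [coeff_gammaPart_monomial, coeff_etaPart_monomial d, coeff_zero] at h1
    rw [Matrix.mulVec, dotProduct, Fintype.sum_sum_type, Pi.zero_apply, add_comm]
    exact h1

end LogMatrix

/-! ### Evaluation and degree of the minors -/

section Determinants

open Polynomial

/-- A nonidentity permutation with nonzero product would strictly lower the total rank, yet a
permutation preserves that sum. -/
theorem Matrix.det_eq_prod_diag_of_rank {n R : Type*} [Fintype n] [DecidableEq n] [CommRing R]
    (M : Matrix n n R) (rank : n → ℕ) (h : ∀ r v, r ≠ v → M r v ≠ 0 → rank r < rank v) :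
    M.det = ∏ i, M i i := by
  rw [Matrix.det_apply, Finset.sum_eq_single 1 ?_ (by simp)]
  · simp
  · intro σ _ hσ
    rw [smul_eq_zero_iff_eq]
    by_contra h0
    have hne : ∀ i, M (σ i) i ≠ 0 := fun i h1 => h0 (Finset.prod_eq_zero (Finset.mem_univ i) h1)
    obtain ⟨i, hi⟩ : ∃ i, σ i ≠ i := by
      by_contra! hcon
      exact hσ (Equiv.ext hcon)
    have hlt : ∑ i, rank (σ i) < ∑ i, rank i := by
      refine Finset.sum_lt_sum (fun j _ => ?_) ⟨i, Finset.mem_univ i, h _ _ hi (hne i)⟩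
      by_cases hj : σ j = j
      · rw [hj]
      · exact (h _ _ hj (hne j)).le
    rw [Equiv.sum_comp σ rank] at hlt
    exact lt_irrefl _ hlt

/-- The row weights and the column weights each have a sum independent of the permutation, so one
bound serves all terms of the expansion. -/
theorem Matrix.natDegree_det_add_le {n S : Type*} [Fintype n] [DecidableEq n] [CommRing S]
    (M : Matrix n n S[X]) (a b : n → ℕ) (N : ℕ)
    (h : ∀ r v, M r v ≠ 0 → (M r v).natDegree + a r ≤ b v) (hN : ∑ i, b i ≤ ∑ i, a i + N) :
    M.det.natDegree ≤ N := by
  rw [Matrix.det_apply]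
  refine natDegree_sum_le_of_forall_le _ _ fun σ _ => ?_
  refine (natDegree_smul_le _ _).trans ?_
  by_cases h0 : ∃ i, M (σ i) i = 0
  · obtain ⟨i, hi⟩ := h0
    have h1 : ∏ i, M (σ i) i = 0 := Finset.prod_eq_zero (Finset.mem_univ i) hi
    exact (congrArg natDegree h1).trans_le (by simp)
  · push Not at h0
    have h1 := natDegree_prod_le Finset.univ fun i => M (σ i) i
    have h2 : ∑ i, ((M (σ i) i).natDegree + a (σ i)) ≤ ∑ i, b i :=
      Finset.sum_le_sum fun i _ => h _ _ (h0 i)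
    rw [Finset.sum_add_distrib, Equiv.sum_comp σ a] at h2
    refine h1.trans ?_
    omega

/-- With rows and shifts weighted by total degree, each `η` index contributes nothing to the bound
and each `γ` index contributes `d - β`. -/
theorem natDegree_det_logMatrix_le {S : Type*} [CommRing S] {d β : ℕ} (hβ : β ≤ d)
    (c : ℕ × ℕ → S[X]) (hc : ∀ p, c p ≠ 0 → (c p).natDegree + (p.1 + p.2) ≤ d) :
    (logMatrix d β c).det.natDegree ≤ (gammaExps d).card * (d - β) := by
  refine Matrix.natDegree_det_add_le _ (fun r => (logRow d β r).1 + (logRow d β r).2)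
    (fun v => d + ((logShift d v).1 + (logShift d v).2)) _ (fun r v h => ?_) ?_
  · simp only [logMatrix, Matrix.of_apply] at h ⊢
    split_ifs at h ⊢ with hle
    · have h1 := hc _ (right_ne_zero_of_mul h)
      have h2 : ((logWeight d v (logRow d β r - logShift d v) : S[X]) *
          c (logRow d β r - logShift d v)).natDegree ≤
            (c (logRow d β r - logShift d v)).natDegree := by
        refine natDegree_mul_le.trans ?_
        rw [natDegree_intCast, zero_add]
      have h3 := hle.1
      have h4 := hle.2
      simp only [Prod.fst_sub, Prod.snd_sub] at h1
      omega
    · exact absurd rfl h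
  · rw [Fintype.sum_sum_type, Fintype.sum_sum_type, add_assoc]
    refine add_le_add (Finset.sum_le_sum fun v _ => ?_) ?_
    · simp only [logShift, logRow]; omega
    · have : (gammaExps d).card * (d - β) = ∑ _v : gammaExps d, (d - β) := by simp
      rw [this, ← Finset.sum_add_distrib]
      refine Finset.sum_le_sum fun v _ => ?_
      simp only [logShift, logRow]; omega

/-- The determinant for a polynomial `x ^ d + c (0, d - 1) y ^ (d - 1) + c (0, 1) y`. -/
theorem exists_det_logMatrix_eq {d β : ℕ} (hd : 3 ≤ d) (hβ : β = 1 ∨ β = d - 1) :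
    ∃ κ : ℤ, κ ≠ 0 ∧ ∀ (A : Type) [CommRing A] (c : ℕ × ℕ → A), c (d, 0) = 1 →
      (∀ p, c p ≠ 0 → p = (d, 0) ∨ p = (0, 1) ∨ p = (0, d - 1)) →
      (logMatrix d β c).det = κ * c (0, β) ^ (gammaExps d).card := by
  refine ⟨∏ v, logWeight d v (logRow d β v - logShift d v), ?_, ?_⟩
  · refine Finset.prod_ne_zero_iff.2 fun v _ => ?_
    obtain ⟨⟨⟨i, j⟩, hv⟩⟩ | ⟨⟨⟨i, j⟩, hv⟩⟩ := v
    · have := mem_etaExps.1 hv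
      simp only [logShift, logRow, logWeight, Prod.mk_sub_mk]
      dsimp only at this
      omega
    · have hmem := mem_gammaExps.1 hv
      dsimp only at hmem
      obtain ⟨e, he⟩ : ∃ e : ℕ, d = e + 1 + i := ⟨d - 1 - i, by omega⟩
      simp only [logShift, logRow, logWeight, Prod.mk_sub_mk, Nat.add_sub_cancel_left, Nat.sub_self,
        Nat.cast_zero, mul_zero, sub_zero]
      have he' : (d - 1 - i : ℤ) = e := by rw [he]; push_cast; ring
      rw [he']
      intro h0
      have h1 : j * d = e * β := by exact_mod_cast (sub_eq_zero.1 h0)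
      -- A vanishing diagonal weight means `j * d = e * β` with `0 < e < d`, which is impossible
      -- when `β` is prime to `d`. This holds for both values of `β`.
      have hcop : Nat.Coprime d β := by
        rcases hβ with rfl | rfl
        · exact Nat.coprime_one_right d
        · exact (Nat.coprime_self_sub_right (by omega)).2 (Nat.coprime_one_right d)
      have h2 : d ∣ e := hcop.dvd_of_dvd_mul_right (Dvd.intro_left j h1)
      have := Nat.le_of_dvd (by omega) h2
      omega
  · intro A _ c hc1 hc
    -- An `η` row has no nonzero entry off the diagonal, so `η` gets the highest rank. Between two
    -- `γ` indices such an entry comes from whichever of `y`, `y ^ (d - 1)` is not `y ^ β`; passing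
    -- from row to column it lowers the exponent of `y` by `d - 2` if `β = 1`, and raises it by `d -
    -- 2` if `β = d - 1`.
    rw [Matrix.det_eq_prod_diag_of_rank _
      (Sum.elim (fun _ => d + 1) fun v => if β = 1 then d - v.1.2 else v.1.2)]
    · have hval : ∀ v, logMatrix d β c v v = (logWeight d v (logRow d β v - logShift d v) : A) *
          Sum.elim (fun _ => 1) (fun _ => c (0, β)) v := by
        rintro (v | v)
        · simp [logMatrix, logRow, logShift, hc1]
        · simp [logMatrix, logRow, logShift]
      simp only [hval, Finset.prod_mul_distrib, Int.cast_prod]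
      congr 1
      simp [Fintype.prod_sum_type]
    · intro r v hrv hne
      simp only [logMatrix, Matrix.of_apply, ne_eq, ite_eq_right_iff, Classical.not_imp] at hne
      obtain ⟨hle, hne⟩ := hne
      have hcase := hc _ (right_ne_zero_of_mul hne)
      have hw : logWeight d v (logRow d β r - logShift d v) ≠ 0 := by
        intro h
        rw [h, Int.cast_zero, zero_mul] at hne
        exact hne rfl
      obtain ⟨⟨⟨i, j⟩, hr⟩⟩ | ⟨⟨⟨i, j⟩, hr⟩⟩ := r <;>
      obtain ⟨⟨⟨k, l⟩, hv⟩⟩ | ⟨⟨⟨k, l⟩, hv⟩⟩ := v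
      · exfalso
        have h1 := mem_etaExps.1 hr
        have h2 := mem_etaExps.1 hv
        apply hrv
        simp only [logRow, logShift, Prod.mk_sub_mk, Prod.mk.injEq, Prod.mk_le_mk] at hcase hle
        simp only [Sum.inl.injEq, Subtype.mk.injEq, Prod.mk.injEq]
        dsimp only at h1 h2
        omega
      · exfalso
        have h1 := mem_etaExps.1 hr
        have h2 := mem_gammaExps.1 hv
        simp only [logRow, logShift, Prod.mk_sub_mk, Prod.mk.injEq, Prod.mk_le_mk] at hcase hle
        dsimp only at h1 h2
        obtain ⟨h3, h4⟩ | h3 | h3 := hcase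
        -- The term `x ^ d` has weight zero in every `γ` column.
        · apply hw
          simp only [logRow, logShift, logWeight, Prod.mk_sub_mk, h3, h4]
          have h5 : l = j + 1 := by omega
          have h6 : k = i - 1 := by omega
          push_cast
          ring
        · omega
        · omega
      · have h1 := mem_gammaExps.1 hr
        simp only [Sum.elim_inr, Sum.elim_inl]
        dsimp only at h1 ⊢
        split_ifs <;> omega
      · have h1 := mem_gammaExps.1 hr
        have h2 := mem_gammaExps.1 hv
        simp only [logRow, logShift, Prod.mk_sub_mk, Prod.mk.injEq, Prod.mk_le_mk] at hcase hle
        simp only [ne_eq, Sum.inr.injEq, Subtype.mk.injEq, Prod.mk.injEq] at hrv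
        simp only [Sum.elim_inr]
        dsimp only at h1 h2
        split_ifs <;> omega

end Determinants

/-! ### Elimination by resultants -/

section Elimination

open Polynomial

/-- If `P` and `Q` specialize to polynomials of the shapes `p₀` and `κ * Y ^ n` under `φ`,
where `deg Q ≤ n`, then some element of their ideal lies in `B[X]` and does not vanish under `φ`. -/
theorem exists_eliminant {B K : Type*} [CommRing B] [Field K] (φ : B →+* K) {P Q : B[X][X]}
    {m n : ℕ} (hP : P.natDegree ≤ m) (hQ : Q.natDegree ≤ n) (hn : n ≠ 0) {p₀ : K[X]} (hp₀ : p₀ ≠ 0)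
    (hφP : P.map (mapRingHom φ) = C p₀) {κ : K} (hκ : κ ≠ 0)
    (hφQ : Q.map (mapRingHom φ) = C (C κ) * X ^ n) :
    ∃ R : B[X], R.map φ ≠ 0 ∧ ∃ u v : B[X][X], P * u + Q * v = C R := by
  obtain ⟨u, v, -, -, h⟩ := exists_mul_add_mul_eq_C_resultant P Q hP hQ (Or.inr hn)
  refine ⟨_, ?_, u, v, h⟩
  have h1 := resultant_map_map P Q m n (mapRingHom φ)
  rw [coe_mapRingHom] at h1
  -- With formal degrees `m`, `n` the resultant commutes with `φ` even if `P` drops in degree. Since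
  -- `Q` keeps its full degree `n`, the value is, up to sign, a product of powers of `p₀` and `κ`.
  rw [← h1, hφP, hφQ, resultant_C_left]
  simp [hp₀, hκ]

end Elimination

/-! ### Generic coefficients and the model polynomial -/

section GenericCoefficients

open Polynomial

noncomputable instance (n d : ℕ) : Fintype (MonomialIndex n d) :=
  (Finsupp.finite_of_degree_le d).fintype

/-- The polynomials in the coefficients of a polynomial in `x, y, z, t` of degree at most `d`. -/
abbrev CoeffRing (d : ℕ) : Type := MvPolynomial (MonomialIndex 4 d) ℂ

/-- The coefficient of `x ^ p.1 * y ^ p.2` in the monomial `m`, where the variable with index `s`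
is the inner and the variable with index `o` is the outer polynomial variable. -/
noncomputable def fiberMonomial (A : Type) [CommRing A] (s o : Fin 4) (p : ℕ × ℕ) (m : Fin 4 →₀ ℕ) :
    A[X][X] :=
  if (m 0, m 1) = p then C (X ^ m s) * X ^ m o else 0

/-- The coefficient of `x ^ p.1 * y ^ p.2` in the generic polynomial in `x, y, z, t`. -/
noncomputable def genericCoeff (d : ℕ) (s o : Fin 4) (p : ℕ × ℕ) : (CoeffRing d)[X][X] :=
  ∑ m : MonomialIndex 4 d, C (C (MvPolynomial.X m)) * fiberMonomial (CoeffRing d) s o p m.1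

theorem degree_fin_four (m : Fin 4 →₀ ℕ) : m.degree = m 0 + m 1 + m 2 + m 3 := by
  rw [Finsupp.degree_eq_sum, Fin.sum_univ_four]

theorem natDegree_genericCoeff_le {d : ℕ} {s o : Fin 4} (ho : o = 2 ∨ o = 3) (p : ℕ × ℕ)
    (hp : genericCoeff d s o p ≠ 0) : (genericCoeff d s o p).natDegree + (p.1 + p.2) ≤ d := by
  have key : ∀ m : MonomialIndex 4 d, (m.1 0, m.1 1) = p → m.1 o + (p.1 + p.2) ≤ d := by
    rintro ⟨m, hm⟩ rfl
    rw [degree_fin_four] at hm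
    rcases ho with rfl | rfl <;> dsimp only <;> omega
  obtain ⟨m, -, hm⟩ := Finset.exists_ne_zero_of_sum_ne_zero hp
  have hmp : (m.1 0, m.1 1) = p := by
    by_contra h
    exact hm (by rw [fiberMonomial, if_neg h, mul_zero])
  have h1 := key m hmp
  have h2 : (genericCoeff d s o p).natDegree ≤ d - (p.1 + p.2) := by
    refine natDegree_sum_le_of_forall_le _ _ fun m _ => ?_
    refine (natDegree_C_mul_le _ _).trans ?_
    rw [fiberMonomial]
    split_ifs with h
    · have := key m h
      refine (natDegree_C_mul_X_pow_le _ _).trans (by omega)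
    · simp
  omega

/-- The monomial `x ^ a * y ^ b * z ^ i * t ^ j`. -/
noncomputable def expo4 (a b i j : ℕ) : Fin 4 →₀ ℕ :=
  Finsupp.single 0 a + Finsupp.single 1 b + Finsupp.single 2 i + Finsupp.single 3 j

@[simp] theorem expo4_zero (a b i j : ℕ) : expo4 a b i j 0 = a := by simp [expo4]

@[simp] theorem expo4_one (a b i j : ℕ) : expo4 a b i j 1 = b := by simp [expo4]

@[simp] theorem expo4_two (a b i j : ℕ) : expo4 a b i j 2 = i := by simp [expo4]

@[simp] theorem expo4_three (a b i j : ℕ) : expo4 a b i j 3 = j := by simp [expo4]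

theorem expo4_degree (a b i j : ℕ) : (expo4 a b i j).degree = a + b + i + j := by
  simp [degree_fin_four]

theorem eq_expo4_iff {m : Fin 4 →₀ ℕ} {a b i j : ℕ} :
    m = expo4 a b i j ↔ m 0 = a ∧ m 1 = b ∧ m 2 = i ∧ m 3 = j := by
  refine ⟨by rintro rfl; simp, ?_⟩
  rintro ⟨rfl, rfl, rfl, rfl⟩
  ext k; fin_cases k <;> simp

/-- An element of `MonomialIndex 4 d`. -/
noncomputable def monIdx {d : ℕ} (a b i j : ℕ) (h : a + b + i + j ≤ d) : MonomialIndex 4 d :=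
  ⟨expo4 a b i j, by rwa [expo4_degree]⟩

/-- The coefficients of `x ^ d + y ^ (d - 1) * z + y * t ^ (d - 1)`. -/
noncomputable def modelCoeffs {d : ℕ} (hd : 3 ≤ d) : MonomialIndex 4 d → ℂ :=
  Pi.single (monIdx d 0 0 0 (by omega)) 1 + Pi.single (monIdx 0 (d - 1) 1 0 (by omega)) 1 +
    Pi.single (monIdx 0 1 0 (d - 1) (by omega)) 1

theorem map_genericCoeff_modelCoeffs {d : ℕ} (hd : 3 ≤ d) (s o : Fin 4) (p : ℕ × ℕ) :
    (genericCoeff d s o p).map (mapRingHom (MvPolynomial.eval (modelCoeffs hd))) =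
      fiberMonomial ℂ s o p (expo4 d 0 0 0) + fiberMonomial ℂ s o p (expo4 0 (d - 1) 1 0) +
        fiberMonomial ℂ s o p (expo4 0 1 0 (d - 1)) := by
  classical
  have h : (genericCoeff d s o p).map (mapRingHom (MvPolynomial.eval (modelCoeffs hd))) =
      ∑ m : MonomialIndex 4 d, C (C (modelCoeffs hd m)) * fiberMonomial ℂ s o p m.1 := by
    rw [genericCoeff, Polynomial.map_sum]
    refine Finset.sum_congr rfl fun m _ => ?_
    rw [fiberMonomial, fiberMonomial]
    split_ifs <;> simp
  rw [h]
  simp only [modelCoeffs, Pi.add_apply, Pi.single_apply, map_add, add_mul, Finset.sum_add_distrib,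
    apply_ite (C : ℂ → ℂ[X]), apply_ite (C : ℂ[X] → ℂ[X][X]), map_one, map_zero, ite_mul, one_mul,
    zero_mul, Finset.sum_ite_eq', Finset.mem_univ, if_true]
  rfl

/-- Evaluation of the generic polynomials at coefficients `c` and a point. -/
noncomputable def pointEval {d : ℕ} (c : MonomialIndex 4 d → ℂ) (a b : ℂ) :
    (CoeffRing d)[X][X] →+* ℂ :=
  eval₂RingHom (eval₂RingHom (MvPolynomial.eval c) a) b

theorem pointEval_genericCoeff {d : ℕ} (c : MonomialIndex 4 d → ℂ) (a b : ℂ) (s o : Fin 4)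
    (p : ℕ × ℕ) : pointEval c a b (genericCoeff d s o p) =
      ∑ m : MonomialIndex 4 d, if (m.1 0, m.1 1) = p then c m * (a ^ m.1 s * b ^ m.1 o) else 0 := by
  rw [genericCoeff, map_sum]
  refine Finset.sum_congr rfl fun m _ => ?_
  rw [fiberMonomial]
  split_ifs
  · simp only [pointEval, coe_eval₂RingHom, eval₂_mul, eval₂_C, eval₂_X_pow, MvPolynomial.eval_X]
  · rw [mul_zero, map_zero]

theorem exists_finite_common_zeros_of_map {d : ℕ} (c₀ : MonomialIndex 4 d → ℂ)
    {P Q : (CoeffRing d)[X][X]} {m n : ℕ} (hP : P.natDegree ≤ m) (hQ : Q.natDegree ≤ n)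
    (hn : n ≠ 0) {p₀ : ℂ[X]} (hp₀ : p₀ ≠ 0)
    (hφP : P.map (mapRingHom (MvPolynomial.eval c₀)) = C p₀) {κ : ℂ} (hκ : κ ≠ 0)
    (hφQ : Q.map (mapRingHom (MvPolynomial.eval c₀)) = C (C κ) * X ^ n) :
    ∃ r : CoeffRing d, r ≠ 0 ∧ ∀ c, MvPolynomial.eval c r ≠ 0 →
      {a : ℂ | ∃ b : ℂ, pointEval c a b P = 0 ∧ pointEval c a b Q = 0}.Finite := by
  obtain ⟨R, hR, u, v, huv⟩ := exists_eliminant _ hP hQ hn hp₀ hφP hκ hφQ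
  obtain ⟨n, hn⟩ : ∃ n, (R.map (MvPolynomial.eval c₀)).coeff n ≠ 0 := by
    by_contra! h
    exact hR (Polynomial.ext (by simpa using h))
  rw [coeff_map] at hn
  -- Any coefficient of the eliminant that survives at `c₀` will do: where it is nonzero, the
  -- eliminant is a nonzero polynomial whose roots include the first coordinates of all common
  -- zeros.
  refine ⟨R.coeff n, fun h0 => hn (by rw [h0, map_zero]), fun c hc => ?_⟩
  have hRc : R.map (MvPolynomial.eval c) ≠ 0 := by
    intro h0
    apply hc
    rw [← coeff_map, h0, coeff_zero]
  refine (Polynomial.finite_setOfPred_isRoot hRc).subset ?_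
  rintro a ⟨b, hP0, hQ0⟩
  have h3 := congrArg (pointEval c a b) huv
  rw [map_add, map_mul, map_mul, hP0, hQ0, zero_mul, zero_mul, add_zero] at h3
  simp only [pointEval, coe_eval₂RingHom, eval₂_C] at h3
  rw [Set.mem_ofPred_eq, IsRoot, eval_map, ← h3]

/-- The determinant of the generic matrix. -/
noncomputable def genericDet (d : ℕ) (s o : Fin 4) (β : ℕ) : (CoeffRing d)[X][X] :=
  (logMatrix d β (genericCoeff d s o)).det

theorem map_genericDet {A : Type} [CommRing A] {d : ℕ} (φ : (CoeffRing d)[X][X] →+* A)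
    (s o : Fin 4) (β : ℕ) :
    φ (genericDet d s o β) = (logMatrix d β fun p => φ (genericCoeff d s o p)).det :=
  logMatrix_map (A := (CoeffRing d)[X][X]) φ d β (genericCoeff d s o)

theorem natDegree_genericDet_le {d : ℕ} {s o : Fin 4} (ho : o = 2 ∨ o = 3) {β : ℕ} (hβ : β ≤ d) :
    (genericDet d s o β).natDegree ≤ (gammaExps d).card * (d - β) :=
  natDegree_det_logMatrix_le hβ _ (natDegree_genericCoeff_le ho)

theorem map_genericDet_modelCoeffs {d : ℕ} (hd : 3 ≤ d) {s o : Fin 4} (hs : s = 2 ∨ s = 3)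
    (ho : o = 2 ∨ o = 3) {β : ℕ} (hβ : β = 1 ∨ β = d - 1) :
    ∃ κ : ℂ, κ ≠ 0 ∧
      (genericDet d s o β).map (mapRingHom (MvPolynomial.eval (modelCoeffs hd))) = C (C κ) *
        ((genericCoeff d s o (0, β)).map (mapRingHom (MvPolynomial.eval (modelCoeffs hd)))) ^
          (gammaExps d).card := by
  obtain ⟨κ, hκ, hdet⟩ := exists_det_logMatrix_eq hd hβ
  refine ⟨κ, Int.cast_ne_zero.2 hκ, ?_⟩
  set φ := MvPolynomial.eval (modelCoeffs hd) with hφ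
  set c₀ : ℕ × ℕ → ℂ[X][X] := fun p => (genericCoeff d s o p).map (mapRingHom φ) with hc₀
  have htop : c₀ (d, 0) = 1 := by
    simp only [hc₀, hφ, map_genericCoeff_modelCoeffs, fiberMonomial, expo4_zero, expo4_one,
      Prod.mk.injEq]
    rw [if_pos (by simp), if_neg (by omega), if_neg (by omega)]
    rcases ho with rfl | rfl <;> rcases hs with rfl | rfl <;> simp
  have hsupp : ∀ p, c₀ p ≠ 0 → p = (d, 0) ∨ p = (0, 1) ∨ p = (0, d - 1) := by
    intro p hp
    by_contra! hcon
    apply hp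
    simp only [hc₀, hφ, map_genericCoeff_modelCoeffs, fiberMonomial, expo4_zero, expo4_one]
    rw [if_neg hcon.1.symm, if_neg hcon.2.1.symm, if_neg hcon.2.2.symm, add_zero, add_zero]
  have h := hdet _ c₀ htop hsupp
  rw [← coe_mapRingHom, map_genericDet]
  refine h.trans ?_
  simp [hc₀]

/-- For generic coefficients, the points in whose fibre both determinants vanish have finitely
many first coordinates. -/
theorem exists_finite_common_zeros {d : ℕ} (hd : 3 ≤ d) {s o : Fin 4} (hs : s = 2 ∨ s = 3)
    (ho : o = 2 ∨ o = 3) {β β' k : ℕ} (hβ : β = 1 ∨ β = d - 1) (hβ' : β' = 1 ∨ β' = d - 1)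
    (h1 : (genericCoeff d s o (0, β)).map (mapRingHom (MvPolynomial.eval (modelCoeffs hd))) =
      C (X ^ k))
    (h2 : (genericCoeff d s o (0, β')).map (mapRingHom (MvPolynomial.eval (modelCoeffs hd))) =
      X ^ (d - β')) :
    ∃ r : CoeffRing d, r ≠ 0 ∧ ∀ c, MvPolynomial.eval c r ≠ 0 →
      {a : ℂ | ∃ b : ℂ, ∀ β, pointEval c a b (genericDet d s o β) = 0}.Finite := by
  obtain ⟨κ, hκ, hdet⟩ := map_genericDet_modelCoeffs hd hs ho hβ
  obtain ⟨κ', hκ', hdet'⟩ := map_genericDet_modelCoeffs hd hs ho hβ'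
  have hcard : (gammaExps d).card ≠ 0 :=
    Finset.card_ne_zero_of_mem (a := (0, 0)) (mem_gammaExps.2 ⟨by omega, by omega⟩)
  rw [h1, ← C_pow, ← C_mul] at hdet
  rw [h2, ← pow_mul, mul_comm (d - β')] at hdet'
  obtain ⟨r, hr, h⟩ := exists_finite_common_zeros_of_map (modelCoeffs hd)
    (natDegree_genericDet_le ho (by omega)) (natDegree_genericDet_le ho (by omega))
    (mul_ne_zero hcard (by omega)) (by simp [hκ]) hdet hκ' hdet'
  refine ⟨r, hr, fun c hc => (h c hc).subset ?_⟩
  rintro a ⟨b, hab⟩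
  exact ⟨b, hab _, hab _⟩

/-- For generic coefficients, both determinants vanish at finitely many points only. -/
theorem exists_finite_degenerate {d : ℕ} (hd : 3 ≤ d) :
    ∃ r : CoeffRing d, r ≠ 0 ∧ ∀ c : MonomialIndex 4 d → ℂ, MvPolynomial.eval c r ≠ 0 →
      {q : ℂ × ℂ | ∀ β, (logMatrix d β fun p => ∑ m : MonomialIndex 4 d,
        if (m.1 0, m.1 1) = p then c m * (q.1 ^ m.1 2 * q.2 ^ m.1 3) else 0).det = 0}.Finite := by
  have e1 : ((0, d - 1) : ℕ × ℕ) ≠ (0, 1) := by simp; omega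
  have e2 : ((d, 0) : ℕ × ℕ) ≠ (0, 1) := by simp
  have e3 : ((d, 0) : ℕ × ℕ) ≠ (0, d - 1) := by simp; omega
  -- Here `t` is eliminated: on the model the minor for `d - 1` is a power of `z` and the minor for
  -- `1` a power of `t` of maximal degree. Below, the roles are exchanged, and the common zeros lie
  -- in a product of two finite sets.
  obtain ⟨r, hr, h⟩ := exists_finite_common_zeros hd (s := 2) (o := 3) (.inl rfl) (.inr rfl)
    (β := d - 1) (β' := 1) (k := 1) (.inr rfl) (.inl rfl)
    (by simp [map_genericCoeff_modelCoeffs, fiberMonomial, e1.symm, e3])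
    (by simp [map_genericCoeff_modelCoeffs, fiberMonomial, e1, e2])
  obtain ⟨r', hr', h'⟩ := exists_finite_common_zeros hd (s := 3) (o := 2) (.inr rfl) (.inl rfl)
    (β := 1) (β' := d - 1) (k := d - 1) (.inl rfl) (.inr rfl)
    (by simp [map_genericCoeff_modelCoeffs, fiberMonomial, e1, e2])
    (by
      rw [show d - (d - 1) = 1 by omega]
      simp [map_genericCoeff_modelCoeffs, fiberMonomial, e1.symm, e3])
  refine ⟨r * r', mul_ne_zero hr hr', fun c hc => ?_⟩
  rw [map_mul] at hc
  refine ((h c (left_ne_zero_of_mul hc)).prod (h' c (right_ne_zero_of_mul hc))).subset ?_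
  rintro ⟨a, b⟩ hab
  refine ⟨⟨b, fun β => ?_⟩, ⟨a, fun β => ?_⟩⟩
  · rw [map_genericDet]
    simp only [pointEval_genericCoeff]
    exact hab β
  · rw [map_genericDet]
    simp only [pointEval_genericCoeff, mul_comm (b ^ _)]
    exact hab β

end GenericCoefficients

/-! ### Fibres over points `(z, t)` -/

section Fibres

open MvPolynomial

theorem specializeZT_monomial (m : Fin 4 →₀ ℕ) (a z t : ℂ) :
    specializeZT (monomial m a) z t = monomial (expo (m 0, m 1)) (a * (z ^ m 2 * t ^ m 3)) := by
  rw [specializeZT, aeval_monomial, Finsupp.prod_fintype _ _ (by simp), Fin.prod_univ_four]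
  have h : monomial (expo (m 0, m 1)) (a * (z ^ m 2 * t ^ m 3)) =
      C (a * (z ^ m 2 * t ^ m 3)) * (X 0 ^ m 0 * X 1 ^ m 1) := by
    rw [X_pow_eq_monomial, X_pow_eq_monomial, monomial_mul, C_mul_monomial, expo]
    simp
  rw [h]
  simp [algebraMap_eq]
  ring

theorem sum_coeffVec {d : ℕ} (F : PolySpace 4 d) :
    ∑ m : MonomialIndex 4 d, monomial m.1 (coeffVec F m) = F.1 := by
  classical
  ext m
  rw [coeff_sum]
  simp only [coeff_monomial, coeffVec]
  by_cases hm : coeff m F.1 = 0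
  · rw [hm]
    refine Finset.sum_eq_zero fun n _ => ?_
    split_ifs with h
    · rw [h, hm]
    · rfl
  · have h1 : m.degree ≤ d :=
      (le_totalDegree (mem_support_iff.2 hm)).trans ((mem_restrictTotalDegree _ _ _).1 F.2)
    rw [Finset.sum_eq_single_of_mem (⟨m, h1⟩ : MonomialIndex 4 d) (Finset.mem_univ _)
      fun n _ hn => ?_]
    · rw [if_pos rfl]
    · rw [if_neg fun h => hn (Subtype.ext h)]

theorem coeff_specializeZT {d : ℕ} (F : PolySpace 4 d) (z t : ℂ) (p : ℕ × ℕ) :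
    coeff (expo p) (specializeZT F.1 z t) = ∑ m : MonomialIndex 4 d,
      if (m.1 0, m.1 1) = p then coeffVec F m * (z ^ m.1 2 * t ^ m.1 3) else 0 := by
  classical
  conv_lhs => rw [← sum_coeffVec F, specializeZT, map_sum, coeff_sum]
  refine Finset.sum_congr rfl fun m _ => ?_
  change coeff (expo p) (specializeZT (monomial m.1 (coeffVec F m)) z t) = _
  rw [specializeZT_monomial, coeff_monomial]
  simp only [expo_injective.eq_iff]

theorem totalDegree_specializeZT_le {d : ℕ} (F : PolySpace 4 d) (z t : ℂ) :
    (specializeZT F.1 z t).totalDegree ≤ d := by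
  refine Finset.sup_le fun n hn => ?_
  rw [mem_support_iff, ← expo_mk_self n, coeff_specializeZT] at hn
  obtain ⟨m, -, hm⟩ := Finset.exists_ne_zero_of_sum_ne_zero hn
  have h1 : (m.1 0, m.1 1) = (n 0, n 1) := by
    by_contra h
    exact hm (if_neg h)
  have h2 := m.2
  rw [degree_fin_four] at h2
  rw [Prod.mk.injEq] at h1
  change n.degree ≤ d
  rw [degree_fin_two]
  omega

theorem coeff_specializeZT_top {d : ℕ} (F : PolySpace 4 d) (z t : ℂ) :
    coeff (Finsupp.single 0 d) (specializeZT F.1 z t) =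
      coeffVec F (monIdx d 0 0 0 (by omega)) := by
  rw [show Finsupp.single 0 d = expo (d, 0) by simp [expo], coeff_specializeZT,
    Finset.sum_eq_single_of_mem (monIdx d 0 0 0 (by omega)) (Finset.mem_univ _) fun m _ hm => ?_]
  · simp [monIdx]
  · refine if_neg fun h => hm (Subtype.ext (eq_expo4_iff.2 ?_))
    have h2 := m.2
    rw [degree_fin_four] at h2
    rw [Prod.mk.injEq] at h
    omega

theorem coeff_specializeZT_subtop {d : ℕ} (F : PolySpace 4 d) (z t : ℂ) {a b : ℕ}
    (h : a + b + 1 = d) : coeff (expo (a, b)) (specializeZT F.1 z t) =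
      coeffVec F (monIdx a b 0 0 (by omega)) + coeffVec F (monIdx a b 1 0 (by omega)) * z +
        coeffVec F (monIdx a b 0 1 (by omega)) * t := by
  classical
  have h01 : monIdx a b 0 0 (show _ ≤ d by omega) ≠ monIdx a b 1 0 (by omega) := fun h => by
    simpa [monIdx] using congrArg (fun m => m.1 2) h
  have h02 : monIdx a b 0 0 (show _ ≤ d by omega) ≠ monIdx a b 0 1 (by omega) := fun h => by
    simpa [monIdx] using congrArg (fun m => m.1 3) h
  have h12 : monIdx a b 1 0 (show _ ≤ d by omega) ≠ monIdx a b 0 1 (by omega) := fun h => by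
    simpa [monIdx] using congrArg (fun m => m.1 2) h
  rw [coeff_specializeZT, ← Finset.sum_subset (Finset.subset_univ
    {monIdx a b 0 0 (by omega), monIdx a b 1 0 (by omega), monIdx a b 0 1 (by omega)}),
    Finset.sum_insert (by simp [h01, h02]), Finset.sum_pair h12]
  · simp [monIdx, add_assoc]
  · intro m _ hm
    refine if_neg fun hab => hm ?_
    have h2 := m.2
    rw [degree_fin_four] at h2
    rw [Prod.mk.injEq] at hab
    simp only [Finset.mem_insert, Finset.mem_singleton, Subtype.ext_iff, monIdx, eq_expo4_iff]
    omega

theorem specializeZT_mul (F G : MvPolynomial (Fin 4) ℂ) (z t : ℂ) :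
    specializeZT (F * G) z t = specializeZT F z t * specializeZT G z t :=
  map_mul _ _ _

theorem totalDegree_specializeZT_le_totalDegree (F : MvPolynomial (Fin 4) ℂ) (z t : ℂ) :
    (specializeZT F z t).totalDegree ≤ F.totalDegree :=
  totalDegree_specializeZT_le ⟨F, (mem_restrictTotalDegree _ _ _).2 le_rfl⟩ z t

theorem totalDegree_eq_of_top_ne_zero {d : ℕ} (F : PolySpace 4 d)
    (h : coeffVec F (monIdx d 0 0 0 (by omega)) ≠ 0) : F.1.totalDegree = d := by
  refine le_antisymm ((mem_restrictTotalDegree _ _ _).1 F.2) ?_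
  have h1 : (expo4 d 0 0 0).degree ≤ F.1.totalDegree := le_totalDegree (mem_support_iff.2 h)
  rwa [expo4_degree] at h1

theorem totalDegree_specializeZT_eq {d : ℕ} (F : PolySpace 4 d)
    (h : coeffVec F (monIdx d 0 0 0 (by omega)) ≠ 0) (z t : ℂ) :
    (specializeZT F.1 z t).totalDegree = d := by
  refine le_antisymm (totalDegree_specializeZT_le F z t) ?_
  rw [← coeff_specializeZT_top F z t] at h
  have h1 : (Finsupp.single (0 : Fin 2) d).degree ≤ _ := le_totalDegree (mem_support_iff.2 h)
  rwa [Finsupp.degree_single] at h1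

/-- Specialization preserves the degree of `F`. If one factor becomes a unit, the specialized
cofactor already has degree `d`, so the first factor was constant. -/
theorem irreducible_of_irreducible_specializeZT {d : ℕ} (F : PolySpace 4 d)
    (h : coeffVec F (monIdx d 0 0 0 (by omega)) ≠ 0) {z t : ℂ}
    (hirr : Irreducible (specializeZT F.1 z t)) : Irreducible F.1 := by
  have hdeg := totalDegree_eq_of_top_ne_zero F h
  have hdeg' := totalDegree_specializeZT_eq F h z t
  have hF0 : F.1 ≠ 0 := fun h0 => h (by rw [coeffVec, h0, coeff_zero])
  have key : ∀ G H : MvPolynomial (Fin 4) ℂ, F.1 = G * H → IsUnit (specializeZT G z t) →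
      IsUnit G := by
    intro G H hGH hu
    have hG0 : G ≠ 0 := by rintro rfl; exact hF0 (by rw [hGH, zero_mul])
    have hH0 : H ≠ 0 := by rintro rfl; exact hF0 (by rw [hGH, mul_zero])
    have h1 := (isUnit_iff_totalDegree_of_isReduced.1 hu).2
    have h2 := totalDegree_mul (specializeZT G z t) (specializeZT H z t)
    rw [← specializeZT_mul, ← hGH, hdeg', h1] at h2
    have h3 := totalDegree_specializeZT_le_totalDegree H z t
    have h4 := totalDegree_mul_of_isDomain hG0 hH0
    rw [← hGH, hdeg] at h4
    have h5 := totalDegree_eq_zero_iff_eq_C.1 (show G.totalDegree = 0 by omega)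
    rw [h5]
    refine (IsUnit.mk0 _ fun h6 => hG0 ?_).map C
    rw [h5, h6, C_0]
  refine ⟨fun hu => hirr.not_isUnit (hu.map (aeval _)), fun G H hGH => ?_⟩
  refine (hirr.isUnit_or_isUnit (by rw [hGH, specializeZT_mul])).imp (key G H hGH)
    (key H G (by rw [hGH, mul_comm]))

theorem notMem_supported_of_top_ne_zero {d : ℕ} (hd : d ≠ 0) (F : PolySpace 4 d)
    (h : coeffVec F (monIdx d 0 0 0 (by omega)) ≠ 0) :
    F.1 ∉ supported ℂ ({2, 3} : Set (Fin 4)) := by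
  intro hmem
  have h0 : (0 : Fin 4) ∈ F.1.vars :=
    (mem_vars_iff_mem_support 0).2 ⟨_, mem_support_iff.2 h, by simp [monIdx, hd]⟩
  simpa using mem_supported.1 hmem h0

theorem exists_coeffVec_eq {d : ℕ} (c : MonomialIndex 4 d → ℂ) :
    ∃ F : PolySpace 4 d, coeffVec F = c := by
  classical
  refine ⟨∑ m : MonomialIndex 4 d, ⟨monomial m.1 (c m), ?_⟩, ?_⟩
  · rw [mem_restrictTotalDegree]
    exact (totalDegree_monomial_le _ _).trans m.2
  · ext n
    simp only [coeffVec, AddSubmonoidClass.coe_finsetSum, coeff_sum, coeff_monomial]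
    rw [Finset.sum_eq_single_of_mem n (Finset.mem_univ _) fun m _ hm =>
      if_neg fun h => hm (Subtype.ext h), if_pos rfl]

/-- To prove a property for generic polynomials it suffices to prove it outside of the zeros of a
nonzero polynomial in the coefficients. -/
theorem forGenericPoly_of_eval_ne_zero {d : ℕ} {P : MvPolynomial (Fin 4) ℂ → Prop}
    {r : CoeffRing d} (hr : r ≠ 0)
    (h : ∀ F : PolySpace 4 d, eval (coeffVec F) r ≠ 0 → P F.1) : ForGenericPoly 4 d P := by
  refine ⟨{F | eval (coeffVec F) r ≠ 0}, ⟨Ideal.span {r}, ?_⟩, ?_, h⟩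
  · ext F
    simp [zeroLocus_span, aeval_eq_eval]
  · obtain ⟨c, hc⟩ : ∃ c, eval c r ≠ 0 := by
      by_contra! hcon
      exact hr (MvPolynomial.funext fun c => by rw [hcon, map_zero])
    obtain ⟨F, rfl⟩ := exists_coeffVec_eq c
    exact ⟨F, hc⟩

/-- The determinant of the coefficients of `x ^ (d - 1)` and `x ^ (d - 2) * y` in `z` and `t`. -/
noncomputable def subtopMinor {d : ℕ} (hd : 3 ≤ d) : CoeffRing d :=
  X (monIdx (d - 1) 0 1 0 (by omega)) * X (monIdx (d - 2) 1 0 1 (by omega)) -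
    X (monIdx (d - 1) 0 0 1 (by omega)) * X (monIdx (d - 2) 1 1 0 (by omega))

theorem subtopMinor_ne_zero {d : ℕ} (hd : 3 ≤ d) : subtopMinor hd ≠ 0 := by
  intro h
  -- At this coefficient vector the diagonal entries of the minor are `1` and the others `0`.
  have := congrArg (eval fun m : MonomialIndex 4 d =>
    if m.1 1 = m.1 3 then (1 : ℂ) else 0) h
  simp [subtopMinor, monIdx] at this

/-- The constant coefficient of `x ^ d` fixes the scalar. The two subleading coefficients then give
a linear system in the differences of the coordinates, solved by Cramer's rule. -/
theorem eq_of_specializeZT_eq_smul {d : ℕ} (hd : 3 ≤ d) (F : PolySpace 4 d)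
    (htop : coeffVec F (monIdx d 0 0 0 (by omega)) ≠ 0)
    (hminor : eval (coeffVec F) (subtopMinor hd) ≠ 0) {z₀ t₀ z₁ t₁ l : ℂ}
    (h : specializeZT F.1 z₀ t₀ = l • specializeZT F.1 z₁ t₁) :
    l = 1 ∧ (z₁, t₁) = (z₀, t₀) := by
  have hl : l = 1 := by
    have h1 := congrArg (coeff (Finsupp.single 0 d)) h
    rw [coeff_smul, coeff_specializeZT_top, coeff_specializeZT_top, smul_eq_mul] at h1
    exact (mul_eq_right₀ htop).1 h1.symm
  subst hl
  rw [one_smul] at h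
  have h1 := congrArg (coeff (expo (d - 1, 0))) h
  have h2 := congrArg (coeff (expo (d - 2, 1))) h
  rw [coeff_specializeZT_subtop _ _ _ (by omega), coeff_specializeZT_subtop _ _ _ (by omega)]
    at h1 h2
  simp only [subtopMinor, map_sub, map_mul, eval_X] at hminor
  set p := coeffVec F (monIdx (d - 1) 0 1 0 (by omega))
  set q := coeffVec F (monIdx (d - 1) 0 0 1 (by omega))
  set u := coeffVec F (monIdx (d - 2) 1 1 0 (by omega))
  set v := coeffVec F (monIdx (d - 2) 1 0 1 (by omega))
  refine ⟨rfl, Prod.ext ?_ ?_⟩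
  · refine mul_left_cancel₀ hminor ?_
    linear_combination q * h2 - v * h1
  · refine mul_left_cancel₀ hminor ?_
    linear_combination u * h1 - p * h2

end Fibres

theorem theorem3p2 (d : ℕ) (hd : 3 ≤ d) :
    ForGenericPoly 4 d (fun F =>
      F.totalDegree = d ∧
      (Irreducible F ∧ F ∉ MvPolynomial.supported ℂ ({2, 3} : Set (Fin 4))) ∧
      {p : ℂ × ℂ | ¬ Irreducible (specializeZT F p.1 p.2)}.Finite ∧
      (∀ z₀ t₀ z₁ t₁ l : ℂ,
        specializeZT F z₀ t₀ = l • specializeZT F z₁ t₁ →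
          l = 1 ∧ (z₁, t₁) = (z₀, t₀))) := by
  obtain ⟨r, hr, hfin⟩ := exists_finite_degenerate hd
  have hr' : r * MvPolynomial.X (monIdx d 0 0 0 (by omega)) * subtopMinor hd ≠ 0 :=
    mul_ne_zero (mul_ne_zero hr (MvPolynomial.X_ne_zero _)) (subtopMinor_ne_zero hd)
  refine forGenericPoly_of_eval_ne_zero hr' fun F hF => ?_
  rw [map_mul, map_mul, MvPolynomial.eval_X] at hF
  have hminor := right_ne_zero_of_mul hF
  have htop := right_ne_zero_of_mul (left_ne_zero_of_mul hF)
  have hred : {p : ℂ × ℂ | ¬ Irreducible (specializeZT F.1 p.1 p.2)}.Finite := by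
    refine (hfin _ (left_ne_zero_of_mul (left_ne_zero_of_mul hF))).subset fun p hp β => ?_
    have h := det_logMatrix_eq_zero_of_not_irreducible (by omega)
      (totalDegree_specializeZT_le F p.1 p.2) (by rwa [coeff_specializeZT_top]) hp β
    simpa only [coeff_specializeZT] using h
  -- Finitely many reducible fibres leave an irreducible one, which yields the irreducibility of `F`
  -- itself.
  obtain ⟨p, hp⟩ := hred.infinite_compl.nonempty
  rw [Set.mem_compl_iff, Set.mem_ofPred_eq, not_not] at hp
  exact ⟨totalDegree_eq_of_top_ne_zero F htop,
    ⟨irreducible_of_irreducible_specializeZT F htop hp,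
      notMem_supported_of_top_ne_zero (by omega) F htop⟩,
    hred, fun _ _ _ _ _ h => eq_of_specializeZT_eq_smul hd F htop hminor h⟩
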